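/- Modal formulas are built from countably many propositional variables $p_0,p_1,p_2,\dots$ using the classical connectives and $\Box$, with $\Diamond=\neg\Box\neg$. A \emph{logic above} $\mathsf{S4}$ is a normal modal logic (a set of formulas containing all propositional tautologies and $\Box(p\to q)\to(\Box p\to\Box q)$ and closed under modus ponens, necessitation and uniform substitution) that contains $\mathsf{S4}$, the least normal modal logic containing $\Box p\to p$ and $\Box p\to\Box\Box p$. For a topological space $X$, let $\mathsf L(X)$ be the set of modal formulas that evaluate to $X$ under every assignment of subsets of $X$ to the variables, where the classical connectives are interpreted as the corresponding Boolean operations, $\Box$ as interior and hence $\Diamond$ as closure. Let $\mathsf{S4.Grz}$ be the least normal modal logic containing $\mathsf{S4}$ and $\Box(\Box(p\to\Box p)\to p)\to p$. For $0<n<\omega$, let $\mathsf{S4.Grz}_n$ be the least normal modal logic containing $\mathsf{S4.Grz}$ and $\mathsf{bd}_n$, where $\mathsf{bd}_1=\Diamond\Box p_1\to p_1$ and $\mathsf{bd}_{n+1}=\Diamond(\Box p_{n+1}\wedge\neg\mathsf{bd}_n)\to p_{n+1}$. Each ordinal $\gamma$ is viewed as a topological space with the interval topology, and $\beta(\gamma)$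 denotes its \v{C}ech--Stone compactification. For $0<m<\omega$, let $\mathsf L_m=\mathsf L(\beta(\omega^m))$. Each nonzero ordinal $\gamma$ is written uniquely in Cantor normal form $\gamma=\omega^{\alpha_k}n_k+\cdots+\omega^{\alpha_1}n_1$, where $0\neq k\in\omega$, each $n_i$ is nonzero and finite, and $0\le\alpha_1<\cdots<\alpha_k$ are ordinals. \textbf{Corollary.} Let $\mathsf L$ be a logic above $\mathsf{S4}$. There exists a nonzero ordinal $\gamma$ such that $\mathsf L=\mathsf L(\beta(\gamma))$ and $\alpha_1$ in the Cantor normal form of $\gamma$ is finite if and only if $\mathsf L$ is one of the following logics: \begin{enumerate} \item $\mathsf L_m$ for some $0<m<\omega$; \item $\mathsf{S4.Grz}$, or $\mathsf{S4.Grz}_n$ for some $0<n<\omega$; \item $\mathsf{S4.Grz}\cap\mathsf L_m$ for some $0<m<\omega$, or $\mathsf{S4.Grz}_n\cap\mathsf L_m$ for some $0<m<n<\omega$. \end{enumerate} -/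

import Mathlib

universe u

open scoped Ordinal

/-! ### Modal formulas -/

/-- Formulas of the basic propositional modal language, with countably many variables. The other
connectives are the usual classical abbreviations. -/
inductive ModalFormula : Type
  | var : ℕ → ModalFormula
  | bot : ModalFormula
  | imp : ModalFormula → ModalFormula → ModalFormula
  | box : ModalFormula → ModalFormula

namespace ModalFormula

/-- Negation. -/
def neg (φ : ModalFormula) : ModalFormula := imp φ bot

/-- Conjunction. -/
def and (φ ψ : ModalFormula) : ModalFormula := neg (imp φ (neg ψ))

/-- Possibility. -/
def dia (φ : ModalFormula) : ModalFormula := neg (box (neg φ))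

/-- Uniform substitution. -/
def subst (σ : ℕ → ModalFormula) : ModalFormula → ModalFormula
  | var i => σ i
  | bot => bot
  | imp φ ψ => imp (subst σ φ) (subst σ ψ)
  | box φ => box (subst σ φ)

/-- Substitution instances of classical propositional tautologies: the formulas that are true under
every two-valued assignment to all formulas which respects `bot` and `imp` (variables and boxed
formulas are treated as atoms). -/
def IsTautology (φ : ModalFormula) : Prop :=
  ∀ v : ModalFormula → Prop, ¬ v bot → (∀ α β, v (imp α β) ↔ (v α → v β)) → v φ

/-- `□(p → q) → (□p → □q)` -/
def axK : ModalFormula :=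
  imp (box (imp (var 0) (var 1))) (imp (box (var 0)) (box (var 1)))

/-- `□p → p` -/
def axT : ModalFormula := imp (box (var 0)) (var 0)

/-- `□p → □□p` -/
def axFour : ModalFormula := imp (box (var 0)) (box (box (var 0)))

/-- The Grzegorczyk axiom `□(□(p → □p) → p) → p`. -/
def grz : ModalFormula :=
  imp (box (imp (box (imp (var 0) (box (var 0)))) (var 0))) (var 0)

/-- The bounded depth formulas `bd₁ = ◇□p₁ → p₁` and
`bdₙ₊₁ = ◇(□pₙ₊₁ ∧ ¬bdₙ) → pₙ₊₁`. The value at `0` is a placeholder. -/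
def bd : ℕ → ModalFormula
  | 0 => bot
  | 1 => imp (dia (box (var 1))) (var 1)
  | n + 2 => imp (dia (and (box (var (n + 2))) (neg (bd (n + 1))))) (var (n + 2))

end ModalFormula

open ModalFormula in
/-- A normal modal logic: a set of formulas containing all tautologies and the axiom `K` which is
closed under modus ponens, necessitation and uniform substitution. -/
structure IsNormalLogic (L : Set ModalFormula) : Prop where
  taut : ∀ φ, IsTautology φ → φ ∈ L
  axK : axK ∈ L
  mp : ∀ φ ψ, imp φ ψ ∈ L → φ ∈ L → ψ ∈ L
  nec : ∀ φ, φ ∈ L → box φ ∈ L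
  subst : ∀ (σ : ℕ → ModalFormula) φ, φ ∈ L → ModalFormula.subst σ φ ∈ L

open ModalFormula in
/-- Derivability from a set `Γ` of axioms in the smallest normal modal logic. -/
inductive ModalDerivable (Γ : Set ModalFormula) : ModalFormula → Prop
  | ax (φ : ModalFormula) : φ ∈ Γ → ModalDerivable Γ φ
  | taut (φ : ModalFormula) : IsTautology φ → ModalDerivable Γ φ
  | axK : ModalDerivable Γ axK
  | mp (φ ψ : ModalFormula) :
      ModalDerivable Γ (imp φ ψ) → ModalDerivable Γ φ → ModalDerivable Γ ψ
  | nec (φ : ModalFormula) : ModalDerivable Γ φ → ModalDerivable Γ (box φ)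
  | subst (σ : ℕ → ModalFormula) (φ : ModalFormula) :
      ModalDerivable Γ φ → ModalDerivable Γ (ModalFormula.subst σ φ)

/-- The least normal modal logic containing `Γ`. -/
def normalLogicOf (Γ : Set ModalFormula) : Set ModalFormula := {φ | ModalDerivable Γ φ}

/-- The logic `S4`. -/
def logicS4 : Set ModalFormula := normalLogicOf {ModalFormula.axT, ModalFormula.axFour}

/-- The logic `S4.Grz`. -/
def logicS4Grz : Set ModalFormula := normalLogicOf (logicS4 ∪ {ModalFormula.grz})

/-- The logic `S4.Grzₙ` (used for `n ≥ 1`). -/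
def logicS4GrzBd (n : ℕ) : Set ModalFormula := normalLogicOf (logicS4Grz ∪ {ModalFormula.bd n})

/-- `L` is a logic above `S4`, i.e. a normal modal logic containing `S4`. -/
def IsLogicAboveS4 (L : Set ModalFormula) : Prop := IsNormalLogic L ∧ logicS4 ⊆ L

/-! ### Topological semantics -/

/-- The subset of `X` denoted by a formula under an assignment `v` of subsets of `X` to the
variables: `□` is interior (hence `◇` is closure). -/
def topEval {X : Type*} [TopologicalSpace X] (v : ℕ → Set X) : ModalFormula → Set X
  | .var i => v i
  | .bot => ∅
  | .imp φ ψ => (topEval v φ)ᶜ ∪ topEval v ψ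
  | .box φ => interior (topEval v φ)

/-- The logic `L(X)` of a topological space `X`: the formulas which evaluate to all of `X` under
every assignment. -/
def topLogic (X : Type*) [TopologicalSpace X] : Set ModalFormula :=
  {φ | ∀ v : ℕ → Set X, topEval v φ = Set.univ}

/-! ### Ordinal spaces -/

/-- The ordinal `γ`, as the set of all smaller ordinals. It carries the subspace topology from the
order topology on the ordinals; as `Set.Iio γ` is order-connected, this is the interval topology
of `γ` (see the next theorem). -/
abbrev OrdinalSpace (γ : Ordinal.{u}) : Type (u + 1) := Set.Iio γ

theorem orderTopology_ordinalSpace (γ : Ordinal.{u}) : OrderTopology (OrdinalSpace γ) :=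
  inferInstance

/-- The logic `L(β(γ))` of the Čech–Stone compactification of the ordinal space `γ`. -/
def logicBeta (γ : Ordinal.{u}) : Set ModalFormula := topLogic (StoneCech (OrdinalSpace γ))

/-- The logic `Lₘ` of `β(ω ^ m)` (used for `m ≥ 1`). -/
def logicBetaOmegaPow (m : ℕ) : Set ModalFormula := logicBeta ((ω : Ordinal.{u}) ^ m)

theorem cnf_ne_nil {γ : Ordinal.{u}} (hγ : γ ≠ 0) : Ordinal.CNF ω γ ≠ [] := by
  rw [Ordinal.CNF.ne_zero hγ]
  exact List.cons_ne_nil _ _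

/-- The least exponent `α₁` in the Cantor normal form `ω ^ α_k * n_k + ⋯ + ω ^ α₁ * n₁` of a nonzero
ordinal `γ`. The list `Ordinal.CNF ω γ` consists of the pairs `(αᵢ, nᵢ)` with decreasing `αᵢ`. -/
noncomputable def leastCNFExponent (γ : Ordinal.{u}) (hγ : γ ≠ 0) : Ordinal.{u} :=
  ((Ordinal.CNF ω γ).getLast (cnf_ne_nil hγ)).1

/-!
The ordinals with finite least exponent in their Cantor normal form are those of the form
`ω ^ m * (c + 1)` with `m` a natural number, and their compactifications split into two pieces whose
logics appear in the list.

* If `m = 0`, the ordinal is a successor, so it is compact and equals its compactification. If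
  `c = 0`, the compactification is that of `ω ^ m`, whose logic is `Lₘ` by definition. In all other
  cases `1 + ω ^ m = ω ^ m` shows that `ω ^ m * (c + 1)` is the disjoint sum of the compact interval
  `[0, ω ^ m * c]` and a copy of `ω ^ m`. As `β` commutes with finite disjoint sums and the logic of
  a disjoint sum is the intersection of the logics (`topLogic_sum`), the logic of the
  compactification is the intersection of `Lₘ` and the logic of `[0, ω ^ m * c]`. No analysis of
  `Lₘ` itself is needed.

* It remains to find the logic of a compact ordinal `δ + 1`: it is `S4.Grz` if `ω ^ k ≤ δ` for all
  `k`, and `S4.Grzₙ` if `ω ^ (n - 1) ≤ δ < ω ^ n`. Soundness holds because ordinals are scattered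
  (`logicS4Grz_subset_topLogic`) and because the Cantor–Bendixson rank is less than `n` below
  `ω ^ n` (`logicS4GrzBd_subset_topLogic`).

* Completeness is proved without passing through finite frames. Over `S4.Grz`, each failure of `□ φ`
  at a world `w` of the canonical model where `φ` holds is witnessed by a world above `w` that does
  not see `w` (`CanonicalWorld.exists_strict_of_grz`). In ascending chains of such witnesses a rank
  decreases: for `S4.Grzₙ` it comes from the formulas `bd`, for `S4.Grz` it is the number of
  subformulas `ψ` of the given formula for which `□(ψ → □ψ)` fails. A world of rank at most `k` is
  then the image of the point `ω ^ k` under a truth-preserving map from the interval `(0, ω ^ k]`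
  to the canonical model (`exists_isCanonicalMap`), built by recursion on `k`: the interval
  `(0, ω ^ (k + 1)]` consists of `ω` many copies of `(0, ω ^ k]`, which carry the maps of the
  witnesses, each infinitely often, and of a top point to which they converge. Since `(0, ω ^ k]` is
  an open subspace of every ordinal above `ω ^ k`, formulas refuted on it are refuted there.
-/

/-! ### Soundness of the topological semantics -/

theorem topEval_and {X : Type*} [TopologicalSpace X] (v : ℕ → Set X) (φ ψ : ModalFormula) :
    topEval v (φ.and ψ) = topEval v φ ∩ topEval v ψ := by
  ext x; simp [ModalFormula.and, ModalFormula.neg, topEval]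

theorem topEval_neg {X : Type*} [TopologicalSpace X] (v : ℕ → Set X) (φ : ModalFormula) :
    topEval v φ.neg = (topEval v φ)ᶜ := by
  simp [ModalFormula.neg, topEval]

theorem topEval_dia {X : Type*} [TopologicalSpace X] (v : ℕ → Set X) (φ : ModalFormula) :
    topEval v φ.dia = closure (topEval v φ) := by
  rw [closure_eq_compl_interior_compl, ModalFormula.dia, topEval_neg, topEval, topEval_neg]

theorem topEval_subst {X : Type*} [TopologicalSpace X] (v : ℕ → Set X) (σ : ℕ → ModalFormula)
    (φ : ModalFormula) :
    topEval v (φ.subst σ) = topEval (fun i => topEval v (σ i)) φ := by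
  induction φ with
  | var i => rfl
  | bot => rfl
  | imp φ ψ h₁ h₂ => simp [ModalFormula.subst, topEval, h₁, h₂]
  | box φ h => simp [ModalFormula.subst, topEval, h]

theorem isNormalLogic_topLogic (X : Type*) [TopologicalSpace X] : IsNormalLogic (topLogic X) where
  taut φ hφ v := by
    refine Set.eq_univ_of_forall fun x => ?_
    exact hφ (fun ψ => x ∈ topEval v ψ) (by simp [topEval])
      (fun α β => by simp [topEval, imp_iff_not_or])
  axK v := by
    refine Set.eq_univ_of_forall fun x => ?_
    simp only [ModalFormula.axK, topEval, Set.mem_union, Set.mem_compl_iff, ← imp_iff_not_or]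
    intro h₁ h₂
    have h : x ∈ interior (((v 0)ᶜ ∪ v 1) ∩ v 0) := by
      rw [interior_inter]
      exact ⟨h₁, h₂⟩
    refine interior_mono ?_ h
    rintro y ⟨h | h, hy⟩
    exacts [absurd hy h, h]
  mp φ ψ h₁ h₂ v := by
    have := h₁ v
    simpa [topEval, h₂ v] using this
  nec φ h v := by simp [topEval, h v]
  subst σ φ h v := by rw [topEval_subst]; exact h _

/-- The least normal modal logic containing `Γ` is contained in every normal modal logic that
contains `Γ`. -/
theorem normalLogicOf_subset {Γ L : Set ModalFormula} (hL : IsNormalLogic L) (h : Γ ⊆ L) :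
    normalLogicOf Γ ⊆ L := by
  intro φ hφ
  induction hφ with
  | ax φ hφ => exact h hφ
  | taut φ hφ => exact hL.taut φ hφ
  | axK => exact hL.axK
  | mp φ ψ _ _ h₁ h₂ => exact hL.mp _ _ h₁ h₂
  | nec φ _ h => exact hL.nec _ h
  | subst σ φ _ h => exact hL.subst _ _ h

theorem logicS4_subset_topLogic (X : Type*) [TopologicalSpace X] : logicS4 ⊆ topLogic X := by
  refine normalLogicOf_subset (isNormalLogic_topLogic X) ?_
  rintro φ (rfl | rfl) v <;> refine Set.eq_univ_of_forall fun x => ?_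
  · simp only [ModalFormula.axT, topEval, Set.mem_union, Set.mem_compl_iff, ← imp_iff_not_or]
    exact fun h => interior_subset h
  · simp [ModalFormula.axFour, topEval]

/-- A scattered `T₁` space validates the Grzegorczyk axiom: where the axiom fails, an isolated point
of the failure set inside a small open set has a punctured neighborhood contained in `p`. -/
theorem logicS4Grz_subset_topLogic (X : Type*) [TopologicalSpace X] [T1Space X]
    (hX : ∀ S : Set X, S.Nonempty → ∃ y ∈ S, ∃ V, IsOpen V ∧ y ∈ V ∧ V ∩ S ⊆ {y}) :
    logicS4Grz ⊆ topLogic X := by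
  refine normalLogicOf_subset (isNormalLogic_topLogic X)
    (Set.union_subset (logicS4_subset_topLogic X) ?_)
  rintro φ rfl v
  refine Set.eq_univ_of_forall fun x => ?_
  simp only [ModalFormula.grz, topEval, Set.mem_union, Set.mem_compl_iff, ← imp_iff_not_or]
  set P := v 0
  intro hx
  by_contra hxP
  obtain ⟨U, hU, hUo, hxU⟩ := mem_interior.1 hx
  obtain ⟨y, ⟨hyU, hyP⟩, V, hV, hyV, hVS⟩ := hX (U \ P) ⟨x, hxU, hxP⟩
  have hsub : (V ∩ U) \ {y} ⊆ P := by
    rintro z ⟨⟨hzV, hzU⟩, hzy⟩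
    by_contra hzP
    exact hzy (hVS ⟨hzV, hzU, hzP⟩)
  rcases hU hyU with h | h
  · refine h (mem_interior.2 ⟨V ∩ U, ?_, hV.inter hUo, hyV, hyU⟩)
    intro z hz
    by_cases hzy : z = y
    · exact Or.inl (hzy ▸ hyP)
    · exact Or.inr (mem_interior.2 ⟨_, hsub, (hV.inter hUo).sdiff isClosed_singleton, hz, hzy⟩)
  · exact hyP h

/-- If `ρ` strictly decreases on punctured neighborhoods, then `bd n` can only fail at points where
`ρ` is at least `n`. -/
theorem le_rank_of_notMem_topEval_bd {X : Type*} [TopologicalSpace X] (ρ : X → ℕ)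
    (hρ : ∀ x, ∃ U, IsOpen U ∧ x ∈ U ∧ ∀ y ∈ U, y ≠ x → ρ y < ρ x) (v : ℕ → Set X) (n : ℕ) :
    ∀ x, x ∉ topEval v (ModalFormula.bd n) → n ≤ ρ x := by
  induction n with
  | zero => simp
  | succ n ih =>
    intro x hx
    obtain ⟨U, hU, hxU, hlt⟩ := hρ x
    cases n with
    | zero =>
      simp only [ModalFormula.bd, topEval, topEval_dia, Set.mem_union, Set.mem_compl_iff, not_or,
        not_not] at hx
      obtain ⟨y, hyU, hy⟩ := mem_closure_iff.1 hx.1 U hU hxU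
      have := hlt y hyU (fun h => hx.2 (h ▸ interior_subset hy))
      omega
    | succ n =>
      simp only [ModalFormula.bd, topEval, topEval_dia, topEval_and, topEval_neg, Set.mem_union,
        Set.mem_compl_iff, not_or, not_not] at hx
      obtain ⟨y, hyU, hy, hyn⟩ := mem_closure_iff.1 hx.1 U hU hxU
      have h₁ := hlt y hyU (fun h => hx.2 (h ▸ interior_subset hy))
      have h₂ := ih y hyn
      omega

theorem logicS4GrzBd_subset_topLogic {X : Type*} [TopologicalSpace X]
    (hGrz : logicS4Grz ⊆ topLogic X) (ρ : X → ℕ)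
    (hρ : ∀ x, ∃ U, IsOpen U ∧ x ∈ U ∧ ∀ y ∈ U, y ≠ x → ρ y < ρ x) {n : ℕ} (hn : ∀ x, ρ x < n) :
    logicS4GrzBd n ⊆ topLogic X := by
  refine normalLogicOf_subset (isNormalLogic_topLogic X) (Set.union_subset hGrz ?_)
  rintro φ rfl v
  refine Set.eq_univ_of_forall fun x => ?_
  by_contra hx
  exact (hn x).not_ge (le_rank_of_notMem_topEval_bd ρ hρ v n x hx)

/-! ### Logics of open subspaces and disjoint sums -/

theorem topEval_preimage {X Y : Type*} [TopologicalSpace X] [TopologicalSpace Y] {f : X → Y}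
    (hf : Continuous f) (hf' : IsOpenMap f) (v : ℕ → Set Y) (φ : ModalFormula) :
    topEval (fun i => f ⁻¹' v i) φ = f ⁻¹' topEval v φ := by
  induction φ with
  | var i => rfl
  | bot => rfl
  | imp φ ψ h₁ h₂ => simp [topEval, h₁, h₂]
  | box φ h => simp [topEval, h, hf'.preimage_interior_eq_interior_preimage hf]

theorem topLogic_subset_of_isOpenEmbedding {X Y : Type*} [TopologicalSpace X] [TopologicalSpace Y]
    {f : X → Y} (hf : Topology.IsOpenEmbedding f) : topLogic Y ⊆ topLogic X := by
  intro φ hφ v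
  have h := topEval_preimage hf.continuous hf.isOpenMap (fun i => f '' v i) φ
  simpa [Set.preimage_image_eq _ hf.injective, hφ (fun i => f '' v i)] using h

theorem topLogic_congr {X Y : Type*} [TopologicalSpace X] [TopologicalSpace Y] (e : X ≃ₜ Y) :
    topLogic X = topLogic Y :=
  (topLogic_subset_of_isOpenEmbedding e.symm.isOpenEmbedding).antisymm
    (topLogic_subset_of_isOpenEmbedding e.isOpenEmbedding)

theorem topLogic_sum (X Y : Type*) [TopologicalSpace X] [TopologicalSpace Y] :
    topLogic (X ⊕ Y) = topLogic X ∩ topLogic Y := by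
  refine Set.Subset.antisymm (Set.subset_inter
    (topLogic_subset_of_isOpenEmbedding Topology.IsOpenEmbedding.inl)
    (topLogic_subset_of_isOpenEmbedding Topology.IsOpenEmbedding.inr)) ?_
  rintro φ ⟨h₁, h₂⟩ v
  refine Set.eq_univ_of_forall ?_
  rintro (x | y)
  · have := topEval_preimage continuous_inl isOpenMap_inl v φ
    rw [h₁] at this
    exact (this ▸ Set.mem_univ x : x ∈ Sum.inl ⁻¹' topEval v φ)
  · have := topEval_preimage continuous_inr isOpenMap_inr v φ
    rw [h₂] at this
    exact (this ▸ Set.mem_univ y : y ∈ Sum.inr ⁻¹' topEval v φ)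

/-! ### The Čech–Stone compactification of compact spaces and disjoint sums -/

theorem nonempty_homeomorph_stoneCech_of_compact (X : Type*) [TopologicalSpace X] [CompactSpace X]
    [T2Space X] : Nonempty (StoneCech X ≃ₜ X) := by
  refine ⟨(isHomeomorph_iff_exists_inverse.2 ⟨continuous_stoneCechExtend (continuous_id (X := X)),
    stoneCechUnit, fun x => ?_, fun x => ?_, continuous_stoneCechUnit⟩).homeomorph⟩
  · refine congr_fun (f := stoneCechUnit ∘ stoneCechExtend continuous_id) (g := id)
      (stoneCech_hom_ext (continuous_stoneCechUnit.comp (continuous_stoneCechExtend _))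
      continuous_id ?_) x
    ext x
    simp [stoneCechExtend_stoneCechUnit]
  · simp [stoneCechExtend_stoneCechUnit]

/-- Both `β` and the disjoint sum are characterized by universal properties, whence they commute. -/
theorem nonempty_homeomorph_stoneCech_sum (X Y : Type u) [TopologicalSpace X]
    [TopologicalSpace Y] : Nonempty (StoneCech (X ⊕ Y) ≃ₜ StoneCech X ⊕ StoneCech Y) := by
  let f₀ : X ⊕ Y → StoneCech X ⊕ StoneCech Y := Sum.map stoneCechUnit stoneCechUnit
  have hf₀ : Continuous f₀ := continuous_stoneCechUnit.sumMap continuous_stoneCechUnit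
  have hl : Continuous fun x : X => stoneCechUnit (Sum.inl x : X ⊕ Y) :=
    continuous_stoneCechUnit.comp continuous_inl
  have hr : Continuous fun y : Y => stoneCechUnit (Sum.inr y : X ⊕ Y) :=
    continuous_stoneCechUnit.comp continuous_inr
  let g : StoneCech X ⊕ StoneCech Y → StoneCech (X ⊕ Y) :=
    Sum.elim (stoneCechExtend hl) (stoneCechExtend hr)
  have hg : Continuous g :=
    (continuous_stoneCechExtend hl).sumElim (continuous_stoneCechExtend hr)
  have hf := continuous_stoneCechExtend hf₀
  have h₁ : g ∘ stoneCechExtend hf₀ = id := by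
    refine stoneCech_hom_ext (hg.comp hf) continuous_id ?_
    ext (x | y) <;> simp [f₀, g, stoneCechExtend_stoneCechUnit]
  have h₂ : (stoneCechExtend hf₀ ∘ g) ∘ Sum.inl = Sum.inl := by
    refine stoneCech_hom_ext (hf.comp (hg.comp continuous_inl)) continuous_inl ?_
    ext x; simp [f₀, g, stoneCechExtend_stoneCechUnit]
  have h₃ : (stoneCechExtend hf₀ ∘ g) ∘ Sum.inr = Sum.inr := by
    refine stoneCech_hom_ext (hf.comp (hg.comp continuous_inr)) continuous_inr ?_
    ext x; simp [f₀, g, stoneCechExtend_stoneCechUnit]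
  refine ⟨(isHomeomorph_iff_exists_inverse.2 ⟨hf, g, congr_fun h₁, ?_, hg⟩).homeomorph⟩
  rintro (x | y)
  exacts [congr_fun h₂ x, congr_fun h₃ y]

theorem nonempty_homeomorph_stoneCech_congr {X Y : Type u} [TopologicalSpace X]
    [TopologicalSpace Y] (e : X ≃ₜ Y) : Nonempty (StoneCech X ≃ₜ StoneCech Y) := by
  have hf : Continuous fun x => stoneCechUnit (e x) := continuous_stoneCechUnit.comp e.continuous
  have hg : Continuous fun y => stoneCechUnit (e.symm y) :=
    continuous_stoneCechUnit.comp e.symm.continuous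
  have hf' := continuous_stoneCechExtend hf
  have hg' := continuous_stoneCechExtend hg
  refine ⟨(isHomeomorph_iff_exists_inverse.2 ⟨hf', stoneCechExtend hg, ?_, ?_, hg'⟩).homeomorph⟩
  · refine congr_fun (f := stoneCechExtend hg ∘ stoneCechExtend hf) (g := id)
      (stoneCech_hom_ext (hg'.comp hf') continuous_id ?_)
    ext x; simp [stoneCechExtend_stoneCechUnit]
  · refine congr_fun (f := stoneCechExtend hf ∘ stoneCechExtend hg) (g := id)
      (stoneCech_hom_ext (hf'.comp hg') continuous_id ?_)
    ext x; simp [stoneCechExtend_stoneCechUnit]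

/-! ### Maximal consistent theories -/

/-- The iterated implication `a₁ → (a₂ → ⋯ → φ)` with premises the members of the list. -/
def ModalFormula.impList (l : List ModalFormula) (φ : ModalFormula) : ModalFormula :=
  l.foldr ModalFormula.imp φ

/-- `φ` is an `L`-consequence of finitely many members of `X`, without use of necessitation. -/
def LocalConsequence (L X : Set ModalFormula) (φ : ModalFormula) : Prop :=
  ∃ l : List ModalFormula, (∀ a ∈ l, a ∈ X) ∧ ModalFormula.impList l φ ∈ L

/-- A maximal consistent theory of the logic `L`, i.e. a point of its canonical model: a set of
formulas that contains `L` and, as a two-valued assignment, respects `bot` and `imp`. -/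
structure CanonicalWorld (L : Set ModalFormula) where
  /-- The formulas true at the world. -/
  carrier : Set ModalFormula
  subset : L ⊆ carrier
  bot : ModalFormula.bot ∉ carrier
  imp_iff : ∀ φ ψ, ModalFormula.imp φ ψ ∈ carrier ↔ (φ ∈ carrier → ψ ∈ carrier)

open ModalFormula

theorem valuation_impList {v : ModalFormula → Prop}
    (hi : ∀ α β, v (imp α β) ↔ (v α → v β)) (l : List ModalFormula) (φ : ModalFormula) :
    v (impList l φ) ↔ ((∀ a ∈ l, v a) → v φ) := by
  induction l with
  | nil => simp [impList]
  | cons a l ih =>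
    rw [show impList (a :: l) φ = imp a (impList l φ) from rfl, hi, ih]
    simp

namespace LocalConsequence

variable {L X : Set ModalFormula}

theorem of_mem (hL : IsNormalLogic L) {φ : ModalFormula} (h : φ ∈ X) :
    LocalConsequence L X φ := by
  refine ⟨[φ], by simpa using h, hL.taut _ fun v _ hi => ?_⟩
  simp [valuation_impList hi]

theorem of_mem_logic {φ : ModalFormula} (h : φ ∈ L) : LocalConsequence L X φ :=
  ⟨[], by simp, h⟩

theorem mp (hL : IsNormalLogic L) {φ ψ : ModalFormula} (h₁ : LocalConsequence L X (imp φ ψ))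
    (h₂ : LocalConsequence L X φ) : LocalConsequence L X ψ := by
  obtain ⟨l₁, hl₁, h₁⟩ := h₁
  obtain ⟨l₂, hl₂, h₂⟩ := h₂
  refine ⟨l₁ ++ l₂, ?_, hL.mp _ _ (hL.mp _ _ (hL.taut _ fun v _ hi => ?_) h₁) h₂⟩
  · simpa [or_imp, forall_and] using ⟨hl₁, hl₂⟩
  · simp only [hi, valuation_impList hi, List.mem_append, or_imp, forall_and]
    exact fun h₁ h₂ h => h₁ h.1 (h₂ h.2)

/-- The deduction theorem for local consequence. -/
theorem imp_of_insert (hL : IsNormalLogic L) {φ ψ : ModalFormula}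
    (h : LocalConsequence L (insert φ X) ψ) : LocalConsequence L X (imp φ ψ) := by
  classical
  obtain ⟨l, hl, h⟩ := h
  refine ⟨l.filter (· ≠ φ), ?_, hL.mp _ _ (hL.taut _ fun v _ hi => ?_) h⟩
  · intro a ha
    simp only [List.mem_filter, decide_eq_true_eq] at ha
    exact (hl a ha.1).resolve_left ha.2
  · simp only [hi, valuation_impList hi, List.mem_filter, decide_eq_true_eq]
    intro h₁ h₂ hφ
    refine h₁ fun a ha => ?_
    by_cases haφ : a = φ
    · exact haφ ▸ hφ
    · exact h₂ a ⟨ha, haφ⟩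

end LocalConsequence

/-- Lindenbaum's lemma. -/
theorem exists_canonicalWorld {L : Set ModalFormula} (hL : IsNormalLogic L) {X : Set ModalFormula}
    {φ : ModalFormula} (h : ¬ LocalConsequence L X φ) :
    ∃ w : CanonicalWorld L, X ⊆ w.carrier ∧ φ ∉ w.carrier := by
  obtain ⟨M, hXM, hM⟩ := zorn_subset_nonempty {S | ¬ LocalConsequence L S φ} (by
    intro c hc hchain hne
    refine ⟨⋃₀ c, ?_, fun s hs => Set.subset_sUnion_of_mem hs⟩
    rintro ⟨l, hl, hlφ⟩
    obtain ⟨S, hS, hlS⟩ := hchain.directedOn.exists_mem_subset_of_finset_subset_biUnion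
      (f := fun s : Set ModalFormula => s) hne (s := (List.finite_toSet l).toFinset) (by
        intro a ha
        simpa [Set.sUnion_eq_biUnion] using hl a (by simpa using ha))
    exact hc hS ⟨l, fun a ha => hlS (by simpa using ha), hlφ⟩) X h
  have hcon : ¬ LocalConsequence L M φ := hM.prop
  have hins : ∀ ψ, ψ ∉ M → LocalConsequence L M (ModalFormula.imp ψ φ) := by
    intro ψ hψ
    refine LocalConsequence.imp_of_insert hL ?_
    by_contra h'
    exact hψ (hM.le_of_ge h' (Set.subset_insert ψ M) (Set.mem_insert ψ M))
  have hclosed : ∀ ψ, LocalConsequence L M ψ → ψ ∈ M := by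
    intro ψ hψ
    by_contra hψM
    exact hcon ((hins ψ hψM).mp hL hψ)
  refine ⟨⟨M, fun ψ hψ => hclosed ψ (.of_mem_logic hψ), ?_, ?_⟩, hXM, ?_⟩
  · intro hb
    refine hcon (LocalConsequence.mp hL (.of_mem_logic (hL.taut (imp bot φ) ?_))
      (.of_mem hL hb))
    intro v hv hi
    simp [hi, hv]
  · intro α β
    refine ⟨fun hαβ hα => hclosed β ((LocalConsequence.of_mem hL hαβ).mp hL (.of_mem hL hα)), ?_⟩
    intro hαβ
    by_cases hα : α ∈ M
    · refine hclosed _ (LocalConsequence.mp hL (.of_mem_logic (hL.taut (imp β (imp α β)) ?_))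
        (.of_mem hL (hαβ hα)))
      intro v hv hi
      simp only [hi]
      tauto
    · by_contra hi
      -- Peirce's law: both `α → φ` and `(α → β) → φ` are consequences, hence so is `φ`.
      refine hcon ((LocalConsequence.mp hL (.of_mem_logic (hL.taut
        (imp (imp α φ) (imp (imp (imp α β) φ) φ)) ?_)) (hins α hα)).mp hL (hins _ hi))
      intro v hv hi
      simp only [hi]
      tauto
  · exact fun hφ => hcon (.of_mem hL hφ)

/-! ### The canonical model -/

namespace CanonicalWorld

variable {L : Set ModalFormula}

/-- The accessibility relation of the canonical model of a logic above `S4`. -/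
def Sees (w x : CanonicalWorld L) : Prop := ∀ φ, box φ ∈ w.carrier → box φ ∈ x.carrier

theorem Sees.refl (w : CanonicalWorld L) : w.Sees w := fun _ h => h

theorem Sees.trans {w x y : CanonicalWorld L} (h₁ : w.Sees x) (h₂ : x.Sees y) : w.Sees y :=
  fun φ h => h₂ φ (h₁ φ h)

theorem mem_of_imp_mem_logic (w : CanonicalWorld L) {φ ψ : ModalFormula} (h : imp φ ψ ∈ L)
    (hφ : φ ∈ w.carrier) : ψ ∈ w.carrier :=
  (w.imp_iff φ ψ).1 (w.subset h) hφ

theorem neg_mem (w : CanonicalWorld L) (φ : ModalFormula) :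
    neg φ ∈ w.carrier ↔ φ ∉ w.carrier := by
  simp [neg, w.imp_iff, w.bot]

theorem and_mem (w : CanonicalWorld L) (φ ψ : ModalFormula) :
    φ.and ψ ∈ w.carrier ↔ φ ∈ w.carrier ∧ ψ ∈ w.carrier := by
  simp [ModalFormula.and, neg_mem, w.imp_iff]

theorem box_mp (hL : IsNormalLogic L) (w : CanonicalWorld L) {φ ψ : ModalFormula}
    (h : box (imp φ ψ) ∈ w.carrier) (hφ : box φ ∈ w.carrier) : box ψ ∈ w.carrier := by
  have hK := hL.subst (fun i => if i = 0 then φ else ψ) _ hL.axK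
  exact (w.imp_iff _ _).1 ((w.imp_iff _ _).1 (w.subset hK) h) hφ

end CanonicalWorld

theorem IsLogicAboveS4.axT_mem {L : Set ModalFormula} (hL : IsLogicAboveS4 L)
    (φ : ModalFormula) : ModalFormula.imp (box φ) φ ∈ L :=
  hL.1.subst (fun _ => φ) _ (hL.2 (.ax _ (Or.inl rfl)))

theorem IsLogicAboveS4.axFour_mem {L : Set ModalFormula} (hL : IsLogicAboveS4 L)
    (φ : ModalFormula) :
    ModalFormula.imp (box φ) (box (box φ)) ∈ L :=
  hL.1.subst (fun _ => φ) _ (hL.2 (.ax _ (Or.inr rfl)))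

/-- The necessitation rule relative to boxed premises. -/
theorem CanonicalWorld.box_mem_of_localConsequence {L : Set ModalFormula}
    (hL : IsLogicAboveS4 L) (w : CanonicalWorld L) {φ : ModalFormula}
    (h : LocalConsequence L {ψ | ψ ∈ w.carrier ∧ ∃ χ, ψ = box χ} φ) : box φ ∈ w.carrier := by
  obtain ⟨l, hl, h⟩ := h
  have hbox : box (impList l φ) ∈ w.carrier := w.subset (hL.1.nec _ h)
  clear h
  induction l with
  | nil => exact hbox
  | cons a l ih =>
    obtain ⟨ha, χ, rfl⟩ := hl a (by simp)
    exact ih (fun b hb => hl b (by simp [hb]))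
      (w.box_mp hL.1 hbox (w.mem_of_imp_mem_logic (hL.axFour_mem χ) ha))

theorem CanonicalWorld.exists_sees_notMem {L : Set ModalFormula}
    (hL : IsLogicAboveS4 L) (w : CanonicalWorld L) {φ ψ : ModalFormula}
    (h : box (ModalFormula.imp ψ φ) ∉ w.carrier) :
    ∃ x : CanonicalWorld L, w.Sees x ∧ ψ ∈ x.carrier ∧ φ ∉ x.carrier := by
  obtain ⟨x, hx, hφ⟩ := exists_canonicalWorld hL.1
    (fun h' => h (w.box_mem_of_localConsequence hL (.imp_of_insert hL.1 h')))
  exact ⟨x, fun χ hχ => hx (Or.inr ⟨hχ, χ, rfl⟩), hx (Or.inl rfl), hφ⟩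

/-- Over `S4.Grz`, a world where `φ` is true but not necessary sees a world refuting `φ` that does
not see it back: the formula `□(φ → □φ)` separates the two. -/
theorem CanonicalWorld.exists_strict_of_grz {L : Set ModalFormula}
    (hL : IsLogicAboveS4 L) (hgrz : grz ∈ L)
    (w : CanonicalWorld L) {φ : ModalFormula} (hφ : φ ∈ w.carrier) (hbox : box φ ∉ w.carrier) :
    box (ModalFormula.imp φ (box φ)) ∉ w.carrier ∧ ∃ x : CanonicalWorld L, w.Sees x ∧
      φ ∉ x.carrier ∧ box (ModalFormula.imp φ (box φ)) ∈ x.carrier := by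
  have hmem : box (ModalFormula.imp φ (box φ)) ∉ w.carrier := fun h =>
    hbox ((w.imp_iff _ _).1 (w.mem_of_imp_mem_logic (hL.axT_mem _) h) hφ)
  have hbox' : box (ModalFormula.imp (box (ModalFormula.imp φ (box φ))) φ) ∉ w.carrier := fun h =>
    hbox (w.box_mp hL.1 (w.subset (hL.1.nec _ (hL.1.subst (fun _ => φ) _ hgrz)))
      (w.mem_of_imp_mem_logic (hL.axFour_mem _) h))
  obtain ⟨x, hwx, h₁, h₂⟩ := w.exists_sees_notMem hL hbox'
  exact ⟨hmem, x, hwx, h₂, h₁⟩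

/-! ### Bounded depth in the canonical model -/

/-- `σ` and `τ` yield the same instance of `bd n` if they agree on the variables `1, …, n`. -/
theorem subst_bd_congr {σ τ : ℕ → ModalFormula} (n : ℕ) (h : ∀ i ≤ n, σ i = τ i) :
    (bd n).subst σ = (bd n).subst τ := by
  induction n with
  | zero => rfl
  | succ n ih =>
    cases n with
    | zero => simp [bd, dia, neg, subst, h 1 le_rfl]
    | succ n =>
      simp [bd, dia, neg, ModalFormula.and, subst, h (n + 2) le_rfl,
        ih fun i hi => h i (by omega)]

theorem CanonicalWorld.dia_mem {L : Set ModalFormula} (w : CanonicalWorld L) (hL : IsLogicAboveS4 L)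
    {x : CanonicalWorld L} (hwx : w.Sees x) {φ : ModalFormula} (h : φ ∈ x.carrier) :
    dia φ ∈ w.carrier := by
  rw [dia, w.neg_mem]
  intro h'
  exact (x.neg_mem φ).1 (x.mem_of_imp_mem_logic (hL.axT_mem _) (hwx _ h')) h

/-- The world satisfies every instance of `bd n`, which bounds the length of strictly ascending
chains above it. -/
def CanonicalWorld.BoundedDepth {L : Set ModalFormula} (n : ℕ) (w : CanonicalWorld L) : Prop :=
  ∀ σ, (bd n).subst σ ∈ w.carrier

theorem CanonicalWorld.not_boundedDepth_one {L : Set ModalFormula} (hL : IsLogicAboveS4 L)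
    {w x : CanonicalWorld L} (hwx : w.Sees x) {φ : ModalFormula} (hw : box φ ∉ w.carrier)
    (hx : box φ ∈ x.carrier) : ¬ w.BoundedDepth 1 := by
  intro h
  have h := (w.imp_iff _ _).1 (h fun _ => box φ)
  exact hw (h (w.dia_mem hL hwx (x.mem_of_imp_mem_logic (hL.axFour_mem _) hx)))

theorem CanonicalWorld.BoundedDepth.of_strict {L : Set ModalFormula} (hL : IsLogicAboveS4 L)
    {w x : CanonicalWorld L} (hwx : w.Sees x) {φ : ModalFormula} (hw : box φ ∉ w.carrier)
    (hx : box φ ∈ x.carrier) {n : ℕ} (h : w.BoundedDepth (n + 2)) : x.BoundedDepth (n + 1) := by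
  intro σ
  by_contra hσ
  -- Substitute for the top variable of `bd (n + 2)` a formula that separates `x` from `w`.
  let τ : ℕ → ModalFormula := fun i => if i = n + 2 then box φ else σ i
  have hτ : (bd (n + 1)).subst τ = (bd (n + 1)).subst σ :=
    subst_bd_congr _ fun i hi => if_neg (by omega)
  have h := (w.imp_iff _ _).1 (h τ)
  have hτ' : (var (n + 2)).subst τ = box φ := if_pos rfl
  refine hw (hτ' ▸ h (w.dia_mem hL hwx ((x.and_mem _ _).2 ⟨?_, (x.neg_mem _).2 (hτ ▸ hσ)⟩)))
  change box ((var (n + 2)).subst τ) ∈ x.carrier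
  rw [hτ']
  exact x.mem_of_imp_mem_logic (hL.axFour_mem _) hx

/-! ### Mapping ordinals into the canonical model -/

/-- The half-open ordinal interval `(0, ω ^ k]`. It consists of `ω` many consecutive copies of
`(0, ω ^ (k - 1)]`, followed by a top point. -/
abbrev OmegaPowInterval (k : ℕ) : Set Ordinal.{u} := Set.Ioc 0 (ω ^ k)

/-- `f` maps `(0, ω ^ k]` to the canonical model in such a way that the truth of `□ φ`, for `φ ∈ T`,
is preserved in both directions: `f` is continuous for the topology of upsets, and failures of `□ φ`
are witnessed arbitrarily close. -/
structure IsCanonicalMap {L : Set ModalFormula} (T : Set ModalFormula) (k : ℕ)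
    (f : Ordinal.{u} → CanonicalWorld L) : Prop where
  sees : ∀ a ∈ OmegaPowInterval k, ∃ b < a, ∀ c, b < c → c ≤ a → (f a).Sees (f c)
  refutes : ∀ a ∈ OmegaPowInterval k, ∀ φ ∈ T, box φ ∉ (f a).carrier →
    ∀ b < a, ∃ c, b < c ∧ c ≤ a ∧ φ ∉ (f c).carrier

theorem isCanonicalMap_const {L : Set ModalFormula} {T : Set ModalFormula} (k : ℕ)
    {w : CanonicalWorld L} (h : ∀ φ ∈ T, φ ∈ w.carrier → box φ ∈ w.carrier) :
    IsCanonicalMap.{u} T k fun _ => w where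
  sees _ ha := ⟨0, ha.1, fun _ _ _ => .refl w⟩
  refutes a _ φ hφ hbox _ hb := ⟨a, hb, le_rfl, fun h' => hbox (h φ hφ h')⟩

theorem omega0_pow_pos (k : ℕ) : (0 : Ordinal.{u}) < ω ^ k := pow_pos Ordinal.omega0_pos k

theorem omega0_pow_mul_add_le (k i : ℕ) {e : Ordinal.{u}} (he : e ≤ ω ^ k) :
    (ω : Ordinal) ^ k * i + e ≤ ω ^ k * (i + 1 : ℕ) := by
  push_cast
  rw [mul_add_one]
  gcongr

theorem omega0_pow_mul_natCast_lt (k i : ℕ) : (ω : Ordinal.{u}) ^ k * i < ω ^ (k + 1) := by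
  rw [pow_succ]
  exact mul_lt_mul_of_pos_left (Ordinal.natCast_lt_omega0 i) (omega0_pow_pos k)

theorem lt_omega0_pow_succ_iff {k : ℕ} {a : Ordinal.{u}} :
    a < ω ^ (k + 1) ↔ ∃ n : ℕ, a < ω ^ k * n := by
  refine ⟨fun h => ?_, fun ⟨n, hn⟩ => hn.trans (omega0_pow_mul_natCast_lt k n)⟩
  rw [pow_succ, Ordinal.lt_mul_iff_of_isSuccLimit Ordinal.isSuccLimit_omega0] at h
  obtain ⟨c, hc, h⟩ := h
  obtain ⟨n, rfl⟩ := Ordinal.lt_omega0.1 hc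
  exact ⟨n, h⟩

theorem exists_eq_omega0_pow_mul_add {k : ℕ} {a : Ordinal.{u}} (h₀ : 0 < a) (h : a < ω ^ (k + 1)) :
    ∃ (i : ℕ) (e : Ordinal.{u}), e ∈ OmegaPowInterval k ∧ a = ω ^ k * i + e := by
  classical
  obtain ⟨n, hn⟩ := lt_omega0_pow_succ_iff.1 h
  have hex : ∃ n : ℕ, a ≤ ω ^ k * n := ⟨n, hn.le⟩
  obtain ⟨i, hi⟩ : ∃ i, Nat.find hex = i + 1 := by
    refine Nat.exists_eq_succ_of_ne_zero fun h => ?_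
    have := Nat.find_spec hex
    rw [h] at this
    simp [h₀.ne'] at this
  have h₁ : ω ^ k * i < a := not_le.1 (Nat.find_min hex (by omega : i < Nat.find hex))
  have h₂ : a ≤ ω ^ k * (i + 1 : ℕ) := hi ▸ Nat.find_spec hex
  have h₃ := Ordinal.add_sub_cancel_of_le h₁.le
  refine ⟨i, a - ω ^ k * i, ⟨?_, ?_⟩, h₃.symm⟩
  · rw [← h₃] at h₁
    exact (lt_add_iff_pos_right _).1 h₁
  · rw [← h₃] at h₂
    push_cast at h₂
    rw [mul_add_one] at h₂
    exact le_of_add_le_add_left h₂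

theorem omega0_pow_mul_add_inj {k i j : ℕ} {d e : Ordinal.{u}} (hd : d ∈ OmegaPowInterval k)
    (he : e ∈ OmegaPowInterval k) (h : (ω : Ordinal) ^ k * i + d = ω ^ k * j + e) :
    i = j ∧ d = e := by
  have key : ∀ {i j : ℕ} {d e : Ordinal.{u}}, d ∈ OmegaPowInterval k → e ∈ OmegaPowInterval k →
      (ω : Ordinal) ^ k * i + d = ω ^ k * j + e → ¬ i < j := by
    intro i j d e hd he h hij
    refine h.not_lt ?_
    calc (ω : Ordinal) ^ k * i + d ≤ ω ^ k * (i + 1 : ℕ) := omega0_pow_mul_add_le k i hd.2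
      _ ≤ ω ^ k * j := by gcongr; exact_mod_cast hij
      _ < ω ^ k * j + e := (lt_add_iff_pos_right _).2 he.1
  have hij : i = j := le_antisymm (not_lt.1 (key he hd h.symm)) (not_lt.1 (key hd he h))
  subst hij
  exact ⟨rfl, add_left_cancel h⟩

/-- The function on ordinals that maps `ω ^ k * i + e`, for `0 < e ≤ ω ^ k`, to `G i e`, and all
other ordinals to `w`. -/
noncomputable def glueBlocks {W : Type*} (k : ℕ) (w : W) (G : ℕ → Ordinal.{u} → W)
    (a : Ordinal.{u}) : W :=
  open Classical in
  if h : ∃ p : ℕ × Ordinal.{u}, p.2 ∈ OmegaPowInterval k ∧ a = ω ^ k * p.1 + p.2 then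
    G h.choose.1 h.choose.2
  else w

theorem glueBlocks_add {W : Type*} {k : ℕ} (w : W) (G : ℕ → Ordinal.{u} → W) (i : ℕ)
    {e : Ordinal.{u}} (he : e ∈ OmegaPowInterval k) :
    glueBlocks k w G (ω ^ k * i + e) = G i e := by
  have h : ∃ p : ℕ × Ordinal.{u}, p.2 ∈ OmegaPowInterval k ∧
      (ω : Ordinal) ^ k * i + e = ω ^ k * p.1 + p.2 := ⟨(i, e), he, rfl⟩
  obtain ⟨h₁, h₂⟩ := omega0_pow_mul_add_inj he h.choose_spec.1 h.choose_spec.2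
  rw [glueBlocks, dif_pos h, ← h₁, ← h₂]

theorem glueBlocks_top {W : Type*} (k : ℕ) (w : W) (G : ℕ → Ordinal.{u} → W) :
    glueBlocks k w G (ω ^ (k + 1)) = w := by
  refine dif_neg ?_
  rintro ⟨⟨i, e⟩, he, h⟩
  exact h.not_gt ((omega0_pow_mul_add_le k i he.2).trans_lt (omega0_pow_mul_natCast_lt k _))

/-- If every failure of `□ φ` that is not a failure of `φ` is witnessed by a world of smaller rank,
then each world `w` of rank at most `k` is the image of the top point under a canonical map on
`(0, ω ^ k]`. Here `Q k w` says that the rank of `w` is at most `k`. On `(0, ω ^ (k + 1)]` the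
blocks carry maps for the witnesses required by `w`, each witness being used in infinitely many blocks. -/
theorem exists_isCanonicalMap {L T : Set ModalFormula} (hT : T.Countable)
    (Q : ℕ → CanonicalWorld L → Prop)
    (h₀ : ∀ w, Q 0 w → ∀ φ ∈ T, φ ∈ w.carrier → box φ ∈ w.carrier)
    (h₁ : ∀ k w, Q (k + 1) w → ∀ φ ∈ T, φ ∈ w.carrier → box φ ∉ w.carrier →
      ∃ x, w.Sees x ∧ φ ∉ x.carrier ∧ Q k x) (k : ℕ) :
    ∀ w, Q k w → ∃ f : Ordinal.{u} → CanonicalWorld L, IsCanonicalMap T k f ∧ f (ω ^ k) = w ∧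
      ∀ a ∈ OmegaPowInterval k, w.Sees (f a) := by
  induction k with
  | zero =>
    exact fun w hw => ⟨fun _ => w, isCanonicalMap_const 0 (h₀ w hw), rfl, fun _ _ => .refl w⟩
  | succ k ih =>
    intro w hw
    let N : Set ModalFormula := {φ | φ ∈ T ∧ φ ∈ w.carrier ∧ box φ ∉ w.carrier}
    rcases N.eq_empty_or_nonempty with hN | hN
    · refine ⟨fun _ => w, isCanonicalMap_const _ fun φ hφ hφw => ?_, rfl, fun _ _ => .refl w⟩
      by_contra hbox
      exact hN.subset (⟨hφ, hφw, hbox⟩ : φ ∈ N)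
    have : Nonempty N := hN.to_subtype
    have : Countable N := (hT.mono fun φ hφ => hφ.1).to_subtype
    obtain ⟨s, hs⟩ := exists_surjective_nat N
    choose x hwx hx hQ using fun φ : N => h₁ k w hw φ φ.2.1 φ.2.2.1 φ.2.2.2
    choose g hg hgtop hgsees using fun φ : N => ih (x φ) (hQ φ)
    -- The sequence `i ↦ s i.unpair.1` takes every value infinitely often.
    let G : ℕ → Ordinal.{u} → CanonicalWorld L := fun i => g (s i.unpair.1)
    have htop := glueBlocks_top k w G
    have hblock : ∀ (i : ℕ) {e : Ordinal.{u}}, e ∈ OmegaPowInterval k →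
        glueBlocks k w G (ω ^ k * i + e) = G i e := fun i e he => glueBlocks_add w G i he
    have hsees : ∀ a ∈ OmegaPowInterval (k + 1), w.Sees (glueBlocks k w G a) := by
      rintro a ⟨ha₀, ha⟩
      rcases ha.eq_or_lt with rfl | ha
      · rw [htop]
        exact .refl w
      · obtain ⟨i, e, he, rfl⟩ := exists_eq_omega0_pow_mul_add ha₀ ha
        rw [hblock i he]
        exact (hwx _).trans (hgsees _ e he)
    refine ⟨glueBlocks k w G, ⟨?_, ?_⟩, htop, hsees⟩
    · rintro a ⟨ha₀, ha⟩
      rcases ha.eq_or_lt with rfl | ha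
      · refine ⟨0, ha₀, fun c hc hc' => ?_⟩
        rw [htop]
        exact hsees c ⟨hc, hc'⟩
      · obtain ⟨i, e, he, rfl⟩ := exists_eq_omega0_pow_mul_add ha₀ ha
        obtain ⟨b, hb, hb'⟩ := (hg (s i.unpair.1)).sees e he
        refine ⟨ω ^ k * i + b, by gcongr, fun c hc hc' => ?_⟩
        have hcsub := Ordinal.add_sub_cancel_of_le ((le_self_add).trans hc.le)
        rw [← hcsub] at hc hc' ⊢
        have h₁ := lt_of_add_lt_add_left hc
        have h₂ := le_of_add_le_add_left hc'
        rw [hblock i he, hblock i ⟨zero_le.trans_lt h₁, h₂.trans he.2⟩]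
        exact hb' _ h₁ h₂
    · rintro a ⟨ha₀, ha⟩ φ hφ hbox b hb
      rcases ha.eq_or_lt with rfl | ha
      · rw [htop] at hbox
        by_cases hφw : φ ∈ w.carrier
        · obtain ⟨m, hm⟩ := hs ⟨φ, hφ, hφw, hbox⟩
          obtain ⟨n, hn⟩ := lt_omega0_pow_succ_iff.1 hb
          have hmem : (ω : Ordinal.{u}) ^ k ∈ OmegaPowInterval k := ⟨omega0_pow_pos k, le_rfl⟩
          refine ⟨ω ^ k * (Nat.pair m n : ℕ) + ω ^ k, ?_, ?_, ?_⟩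
          · refine (hn.trans_le ?_).trans_le le_self_add
            gcongr
            exact_mod_cast Nat.right_le_pair m n
          · exact (omega0_pow_mul_add_le k _ le_rfl).trans (omega0_pow_mul_natCast_lt k _).le
          · rw [hblock _ hmem]
            simp only [G, Nat.unpair_pair, hgtop, hm]
            exact hx ⟨φ, hφ, hφw, hbox⟩
        · exact ⟨_, hb, le_rfl, by rwa [htop]⟩
      · obtain ⟨i, e, he, rfl⟩ := exists_eq_omega0_pow_mul_add ha₀ ha
        rw [hblock i he] at hbox
        have hb' : b - ω ^ k * i < e := by
          rcases le_total (ω ^ k * i : Ordinal) b with h | h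
          · rw [← Ordinal.add_sub_cancel_of_le h] at hb
            exact lt_of_add_lt_add_left hb
          · rw [Ordinal.sub_eq_zero_iff_le.2 h]
            exact he.1
        obtain ⟨c, hc, hc', hφc⟩ := (hg (s i.unpair.1)).refutes e he φ hφ hbox _ hb'
        refine ⟨ω ^ k * i + c, ?_, by gcongr, ?_⟩
        · exact (Ordinal.le_add_sub _ _).trans_lt (by gcongr)
        · rw [hblock i ⟨zero_le.trans_lt hc, hc'.trans he.2⟩]
          exact hφc

/-! ### Completeness with respect to ordinals -/

/-- The set of subformulas of a formula. -/
def ModalFormula.subformulas : ModalFormula → Set ModalFormula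
  | var i => {var i}
  | bot => {bot}
  | imp φ ψ => insert (imp φ ψ) (subformulas φ ∪ subformulas ψ)
  | box φ => insert (box φ) (subformulas φ)

theorem ModalFormula.finite_subformulas (φ : ModalFormula) : φ.subformulas.Finite := by
  induction φ with
  | var i => exact Set.finite_singleton _
  | bot => exact Set.finite_singleton _
  | imp φ ψ h₁ h₂ => exact (h₁.union h₂).insert _
  | box φ h => exact h.insert _

theorem ModalFormula.mem_subformulas_self (φ : ModalFormula) : φ ∈ φ.subformulas := by
  cases φ <;> simp [subformulas]

theorem mem_interior_omegaPowInterval {k : ℕ} {S : Set (OmegaPowInterval.{u} k)}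
    {a : OmegaPowInterval.{u} k} :
    a ∈ interior S ↔ ∃ b < a.1, ∀ c (h₁ : b < c) (h₂ : c ≤ a.1),
      ⟨c, zero_le.trans_lt h₁, h₂.trans a.2.2⟩ ∈ S := by
  rw [mem_interior_iff_mem_nhds, nhds_subtype_eq_comap,
    ((SuccOrder.hasBasis_nhds_Ioc_of_exists_lt ⟨0, a.2.1⟩).comap _).mem_iff]
  refine exists_congr fun b => and_congr_right fun _ => ?_
  exact ⟨fun h c h₁ h₂ => h ⟨h₁, h₂⟩, fun h c hc => h c.1 hc.1 hc.2⟩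

theorem IsCanonicalMap.mem_topEval_iff {L T : Set ModalFormula} (hL : IsLogicAboveS4 L) {k : ℕ}
    {f : Ordinal.{u} → CanonicalWorld L} (hf : IsCanonicalMap T k f) (φ : ModalFormula)
    (hφ : φ.subformulas ⊆ T) (a : OmegaPowInterval.{u} k) :
    a ∈ topEval (fun i => {b : OmegaPowInterval.{u} k | var i ∈ (f b.1).carrier}) φ ↔
      φ ∈ (f a.1).carrier := by
  induction φ generalizing a with
  | var i => rfl
  | bot => simp [topEval, (f a.1).bot]
  | imp φ ψ h₁ h₂ =>
    simp only [subformulas, Set.insert_subset_iff, Set.union_subset_iff] at hφ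
    rw [(f a.1).imp_iff, ← h₁ hφ.2.1, ← h₂ hφ.2.2]
    simp [topEval, imp_iff_not_or]
  | box φ ih =>
    simp only [subformulas, Set.insert_subset_iff] at hφ
    rw [topEval, mem_interior_omegaPowInterval]
    simp only [ih hφ.2]
    constructor
    · rintro ⟨b, hb, h⟩
      by_contra hbox
      obtain ⟨c, hc, hc', hφc⟩ := hf.refutes a.1 a.2 φ (hφ.2 φ.mem_subformulas_self) hbox b hb
      exact hφc (h c hc hc')
    · intro h
      obtain ⟨b, hb, hsees⟩ := hf.sees a.1 a.2
      exact ⟨b, hb, fun c hc hc' =>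
        (f c).mem_of_imp_mem_logic (hL.axT_mem φ) (hsees c hc hc' φ h)⟩

theorem not_mem_topLogic_omegaPowInterval {L : Set ModalFormula} (hL : IsLogicAboveS4 L)
    {φ : ModalFormula} {w : CanonicalWorld L} (hφ : φ ∉ w.carrier)
    (Q : ℕ → CanonicalWorld L → Prop)
    (h₀ : ∀ w, Q 0 w → ∀ ψ ∈ φ.subformulas, ψ ∈ w.carrier → box ψ ∈ w.carrier)
    (h₁ : ∀ k w, Q (k + 1) w → ∀ ψ ∈ φ.subformulas, ψ ∈ w.carrier → box ψ ∉ w.carrier →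
      ∃ x, w.Sees x ∧ ψ ∉ x.carrier ∧ Q k x) {k : ℕ} (hw : Q k w) :
    φ ∉ topLogic (OmegaPowInterval.{u} k) := by
  obtain ⟨f, hf, hftop, -⟩ :=
    exists_isCanonicalMap.{u} φ.finite_subformulas.countable Q h₀ h₁ k w hw
  intro h
  have hmem := (hf.mem_topEval_iff hL φ subset_rfl ⟨ω ^ k, omega0_pow_pos k, le_rfl⟩).1
    (h _ ▸ Set.mem_univ _)
  rw [hftop] at hmem
  exact hφ hmem

theorem exists_canonicalWorld_notMem {L : Set ModalFormula} (hL : IsNormalLogic L)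
    {φ : ModalFormula} (h : φ ∉ L) : ∃ w : CanonicalWorld L, φ ∉ w.carrier := by
  obtain ⟨w, -, hw⟩ := exists_canonicalWorld hL (X := ∅) (φ := φ) (by
    rintro ⟨l, hl, hφ⟩
    obtain rfl : l = [] := List.eq_nil_iff_forall_not_mem.2 hl
    exact h hφ)
  exact ⟨w, hw⟩

theorem isNormalLogic_normalLogicOf (Γ : Set ModalFormula) : IsNormalLogic (normalLogicOf Γ) :=
  ⟨.taut, .axK, .mp, .nec, .subst⟩

theorem isLogicAboveS4_logicS4Grz : IsLogicAboveS4 logicS4Grz :=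
  ⟨isNormalLogic_normalLogicOf _, fun _ h => .ax _ (Or.inl h)⟩

theorem grz_mem_logicS4Grz : grz ∈ logicS4Grz := .ax _ (Or.inr rfl)

theorem logicS4Grz_subset_logicS4GrzBd (n : ℕ) : logicS4Grz ⊆ logicS4GrzBd n :=
  fun _ h => .ax _ (Or.inl h)

theorem isLogicAboveS4_logicS4GrzBd (n : ℕ) : IsLogicAboveS4 (logicS4GrzBd n) :=
  ⟨isNormalLogic_normalLogicOf _,
    isLogicAboveS4_logicS4Grz.2.trans (logicS4Grz_subset_logicS4GrzBd n)⟩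

/-- `S4.Grzₙ` is complete for `(0, ω ^ (n - 1)]`. -/
theorem topLogic_omegaPowInterval_subset_logicS4GrzBd (k : ℕ) :
    topLogic (OmegaPowInterval.{u} k) ⊆ logicS4GrzBd (k + 1) := by
  intro φ hφ
  by_contra hφL
  have hL := isLogicAboveS4_logicS4GrzBd (k + 1)
  have hgrz := logicS4Grz_subset_logicS4GrzBd (k + 1) grz_mem_logicS4Grz
  obtain ⟨w, hw⟩ := exists_canonicalWorld_notMem hL.1 hφL
  refine not_mem_topLogic_omegaPowInterval hL hw (fun k w => w.BoundedDepth (k + 1)) ?_ ?_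
    (k := k) (fun σ => w.subset (hL.1.subst σ _ (.ax _ (Or.inr rfl)))) hφ
  · intro w hw ψ _ hψ
    by_contra hbox
    obtain ⟨h, x, hwx, -, hx⟩ := w.exists_strict_of_grz hL hgrz hψ hbox
    exact CanonicalWorld.not_boundedDepth_one hL hwx h hx hw
  · intro k w hw ψ _ hψ hbox
    obtain ⟨h, x, hwx, hψx, hx⟩ := w.exists_strict_of_grz hL hgrz hψ hbox
    exact ⟨x, hwx, hψx, hw.of_strict hL hwx h hx⟩

/-- `S4.Grz` is complete for the intervals `(0, ω ^ k]`. The rank of a world is the number of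
subformulas `ψ` for which `□(ψ → □ψ)` fails there. -/
theorem iInter_topLogic_omegaPowInterval_subset_logicS4Grz :
    ⋂ k, topLogic (OmegaPowInterval.{u} k) ⊆ logicS4Grz := by
  intro φ hφ
  by_contra hφL
  have hL := isLogicAboveS4_logicS4Grz
  obtain ⟨w, hw⟩ := exists_canonicalWorld_notMem hL.1 hφL
  let R : CanonicalWorld logicS4Grz → Set ModalFormula := fun w =>
    {ψ | ψ ∈ φ.subformulas ∧ box (imp ψ (box ψ)) ∉ w.carrier}
  have hfin : ∀ w, (R w).Finite := fun w => φ.finite_subformulas.subset fun ψ hψ => hψ.1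
  have hlt : ∀ {w x : CanonicalWorld logicS4Grz} {ψ : ModalFormula}, w.Sees x →
      ψ ∈ φ.subformulas → box (imp ψ (box ψ)) ∉ w.carrier → box (imp ψ (box ψ)) ∈ x.carrier →
      (R x).ncard < (R w).ncard := fun {w x ψ} hwx hψ h h' =>
    Set.ncard_lt_ncard (Set.ssubset_iff_exists.2
      ⟨fun χ hχ => ⟨hχ.1, fun h => hχ.2 (hwx _ h)⟩, ψ, ⟨hψ, h⟩, fun h'' => h''.2 h'⟩) (hfin w)
  refine not_mem_topLogic_omegaPowInterval hL hw (fun k w => (R w).ncard ≤ k) ?_ ?_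
    (k := (R w).ncard) le_rfl (Set.mem_iInter.1 hφ _)
  · intro w hw ψ hψs hψ
    by_contra hbox
    obtain ⟨h, x, hwx, -, hx⟩ := w.exists_strict_of_grz hL grz_mem_logicS4Grz hψ hbox
    have := hlt hwx hψs h hx
    omega
  · intro k w hw ψ hψs hψ hbox
    obtain ⟨h, x, hwx, hψx, hx⟩ := w.exists_strict_of_grz hL grz_mem_logicS4Grz hψ hbox
    have := hlt hwx hψs h hx
    exact ⟨x, hwx, hψx, by omega⟩

/-! ### Divisibility of ordinals by powers of `ω` -/

theorem not_omega0_dvd_add_one (c : Ordinal.{u}) : ¬ ω ∣ c + 1 := by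
  rw [← Ordinal.isSuccPrelimit_iff_omega0_dvd, ← Order.succ_eq_add_one]
  exact Order.not_isSuccPrelimit_succ c

theorem not_omega0_pow_succ_dvd (m : ℕ) (c : Ordinal.{u}) : ¬ ω ^ (m + 1) ∣ ω ^ m * (c + 1) := by
  rintro ⟨d, hd⟩
  rw [pow_succ, mul_assoc] at hd
  exact not_omega0_dvd_add_one c ⟨d, mul_left_cancel₀ (omega0_pow_pos m).ne' hd⟩

theorem exists_eq_omega0_pow_mul_add_one {γ : Ordinal.{u}} (h : ∃ m : ℕ, ¬ ω ^ (m + 1) ∣ γ) :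
    ∃ (m : ℕ) (c : Ordinal.{u}), γ = ω ^ m * (c + 1) := by
  classical
  have hdvd : ω ^ Nat.find h ∣ γ := by
    rcases hm : Nat.find h with _ | m
    · simp
    · exact not_not.1 (Nat.find_min h (by omega : m < Nat.find h))
  obtain ⟨d, hd⟩ := hdvd
  rcases Ordinal.zero_or_succ_or_isSuccLimit d with rfl | ⟨c, rfl⟩ | hlim
  · exact absurd ⟨0, hd.trans (by rw [mul_zero, mul_zero])⟩ (Nat.find_spec h)
  · exact ⟨_, c, by rw [hd, Order.succ_eq_add_one]⟩
  · obtain ⟨e, rfl⟩ := Ordinal.isSuccPrelimit_iff_omega0_dvd.1 hlim.isSuccPrelimit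
    exact absurd ⟨e, hd.trans (by rw [pow_succ, mul_assoc])⟩ (Nat.find_spec h)

theorem exists_not_omega0_pow_succ_dvd {γ : Ordinal.{u}} (h₀ : γ ≠ 0) {n : ℕ} (h : γ < ω ^ n) :
    ∃ m : ℕ, ¬ ω ^ (m + 1) ∣ γ := by
  refine ⟨n, fun hd => (Ordinal.le_of_dvd h₀ hd).not_gt (h.trans ?_)⟩
  exact pow_lt_pow_right₀ Ordinal.one_lt_omega0 n.lt_succ_self

/-- The least exponent `e` of the Cantor normal form of `γ` is characterized by the divisibility of
`γ` by `ω ^ e` but not by `ω ^ (e + 1)`. -/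
theorem leastCNFExponent_dvd {γ : Ordinal.{u}} (hγ : γ ≠ 0) :
    ω ^ leastCNFExponent γ hγ ∣ γ ∧ ¬ ω ^ (leastCNFExponent γ hγ + 1) ∣ γ := by
  induction γ using Ordinal.CNF.rec ω with
  | H0 => exact absurd rfl hγ
  | H o ho ih =>
    have hω := Ordinal.one_lt_omega0
    have hpos : (0 : Ordinal) < ω ^ Ordinal.log ω o := Ordinal.opow_pos _ Ordinal.omega0_pos
    have hdm := Ordinal.div_add_mod o (ω ^ Ordinal.log ω o)
    by_cases hr : o % ω ^ Ordinal.log ω o = 0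
    · have he : leastCNFExponent o hγ = Ordinal.log ω o := by
        simp only [leastCNFExponent, Ordinal.CNF.ne_zero ho, hr, Ordinal.CNF.zero_right,
          List.getLast_singleton]
      rw [he]
      refine ⟨Ordinal.dvd_of_mod_eq_zero hr, fun hd => ?_⟩
      refine (Ordinal.le_of_dvd ho hd).not_gt ?_
      have := Ordinal.lt_opow_succ_log_self hω o
      rwa [Order.succ_eq_add_one] at this
    · have he : leastCNFExponent o hγ = leastCNFExponent _ hr := by
        simp only [leastCNFExponent, Ordinal.CNF.ne_zero ho]
        rw [List.getLast_cons (cnf_ne_nil hr)]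
      obtain ⟨h₁, h₂⟩ := ih hr
      rw [he]
      set r := o % ω ^ Ordinal.log ω o
      have hlt : leastCNFExponent r hr < Ordinal.log ω o := by
        refine (Ordinal.opow_lt_opow_iff_right hω).1 ?_
        exact (Ordinal.le_of_dvd hr h₁).trans_lt (Ordinal.mod_lt _ hpos.ne')
      have key : ∀ e ≤ Ordinal.log ω o, ω ^ e ∣ o ↔ ω ^ e ∣ r := by
        intro e he
        nth_rewrite 1 [← hdm]
        exact Ordinal.dvd_add_iff ((Ordinal.opow_dvd_opow ω he).mul_right _)
      exact ⟨(key _ hlt.le).2 h₁, fun h => h₂ ((key _ (Order.add_one_le_of_lt hlt)).1 h)⟩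

theorem exists_eq_of_leastCNFExponent_lt {γ : Ordinal.{u}} {hγ : γ ≠ 0}
    (h : leastCNFExponent γ hγ < ω) : ∃ (m : ℕ) (c : Ordinal.{u}), γ = ω ^ m * (c + 1) := by
  obtain ⟨m, hm⟩ := Ordinal.lt_omega0.1 h
  have hd := (leastCNFExponent_dvd hγ).2
  refine exists_eq_omega0_pow_mul_add_one ⟨m, ?_⟩
  rwa [hm, ← Nat.cast_add_one, Ordinal.opow_natCast] at hd

theorem leastCNFExponent_lt {γ : Ordinal.{u}} (hγ : γ ≠ 0) {m : ℕ} {c : Ordinal.{u}}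
    (h : γ = ω ^ m * (c + 1)) : leastCNFExponent γ hγ < ω := by
  by_contra hle
  refine not_omega0_pow_succ_dvd m c ?_
  rw [← h, ← Ordinal.opow_natCast]
  exact (Ordinal.opow_dvd_opow ω ((Ordinal.natCast_lt_omega0 _).le.trans (not_lt.1 hle))).trans
    (leastCNFExponent_dvd hγ).1

/-! ### Ordinal spaces -/

theorem isOpen_Iic_ordinal (a : Ordinal.{u}) : IsOpen (Set.Iic a) := by
  rw [← Set.Iio_add_one_eq_Iic]
  exact isOpen_Iio

/-- The greatest `k ≤ n` such that `ω ^ k` divides `a`. For `0 < a < ω ^ n` this is the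
Cantor–Bendixson rank of `a`; at `0` it is set to `0`, as `0` is isolated. -/
noncomputable def omegaRank (n : ℕ) (a : Ordinal.{u}) : ℕ :=
  open Classical in if a = 0 then 0 else Nat.findGreatest (fun k => ω ^ k ∣ a) n

theorem omegaRank_eq {n m : ℕ} {c : Ordinal.{u}} (hm : m ≤ n) :
    omegaRank n (ω ^ m * (c + 1) : Ordinal.{u}) = m := by
  classical
  have hne : (ω : Ordinal.{u}) ^ m * (c + 1) ≠ 0 :=
    mul_ne_zero (omega0_pow_pos m).ne' (Order.succ_eq_add_one c ▸ Order.succ_ne_bot c)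
  rw [omegaRank, if_neg hne]
  refine Nat.findGreatest_eq_iff.2 ⟨hm, fun _ => dvd_mul_right _ _, fun k hk _ hd => ?_⟩
  exact not_omega0_pow_succ_dvd m c ((pow_dvd_pow _ hk).trans hd)

theorem omegaRank_lt {n : ℕ} {a : Ordinal.{u}} (h : a < ω ^ n) (hn : 0 < n) :
    omegaRank n a < n := by
  classical
  rw [omegaRank]
  split_ifs with h₀
  · exact hn
  · refine (Nat.findGreatest_le n).lt_of_ne fun heq => ?_
    have := Nat.findGreatest_of_ne_zero heq hn.ne'
    exact (Ordinal.le_of_dvd h₀ this).not_gt h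

theorem exists_isOpen_omegaRank_lt {n : ℕ} {a : Ordinal.{u}} (ha : a < ω ^ n) :
    ∃ U : Set Ordinal.{u}, IsOpen U ∧ a ∈ U ∧ ∀ b ∈ U, b ≠ a → omegaRank n b < omegaRank n a := by
  classical
  rcases eq_or_ne a 0 with rfl | h₀
  · refine ⟨Set.Iic 0, isOpen_Iic_ordinal 0, Set.mem_Iic.2 le_rfl, fun b hb hne => ?_⟩
    exact absurd (le_zero_iff.1 hb) hne
  obtain ⟨m, c, rfl⟩ :=
    exists_eq_omega0_pow_mul_add_one (exists_not_omega0_pow_succ_dvd h₀ ha)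
  have hm : m < n := by
    refine (pow_lt_pow_iff_right₀ Ordinal.one_lt_omega0).1
      ((Ordinal.le_of_dvd h₀ (dvd_mul_right _ _)).trans_lt ha)
  refine ⟨Set.Ioi (ω ^ m * c) ∩ Set.Iic (ω ^ m * (c + 1)), isOpen_Ioi.inter (isOpen_Iic_ordinal _),
    ⟨?_, Set.mem_Iic.2 le_rfl⟩, ?_⟩
  · rw [Set.mem_Ioi, mul_add_one]
    exact (lt_add_iff_pos_right _).2 (omega0_pow_pos m)
  · rintro b ⟨hb, hb'⟩ hne
    have hlt := lt_of_le_of_ne hb' hne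
    have hsub := Ordinal.add_sub_cancel_of_le (le_of_lt hb)
    rw [omegaRank_eq hm.le, omegaRank, if_neg ((zero_le.trans_lt hb).ne')]
    by_contra hge
    have hd : ω ^ m ∣ b := by
      rcases Nat.eq_zero_or_pos m with rfl | hmpos
      · simp
      · have hne0 : Nat.findGreatest (fun k => ω ^ k ∣ b) n ≠ 0 := by omega
        exact (pow_dvd_pow _ (not_lt.1 hge)).trans (Nat.findGreatest_of_ne_zero rfl hne0)
    -- `b = ω ^ m * c + d` with `0 < d < ω ^ m`, so that `ω ^ m` cannot divide `b`.
    rw [← hsub, Ordinal.dvd_add_iff (dvd_mul_right _ _)] at hd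
    rw [← hsub] at hb hlt
    rw [mul_add_one] at hlt
    have hd₀ := (lt_add_iff_pos_right _).1 (Set.mem_Ioi.1 hb)
    exact (Ordinal.le_of_dvd hd₀.ne' hd).not_gt (lt_of_add_lt_add_left hlt)

theorem logicS4Grz_subset_topLogic_ordinalSpace (γ : Ordinal.{u}) :
    logicS4Grz ⊆ topLogic (OrdinalSpace γ) := by
  refine logicS4Grz_subset_topLogic _ fun S hS => ?_
  obtain ⟨y, hy, hmin⟩ := wellFounded_lt.has_min S hS
  refine ⟨y, hy, {z | z.1 ≤ y.1}, (isOpen_Iic_ordinal _).preimage continuous_subtype_val,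
    Set.mem_ofPred.2 le_rfl, ?_⟩
  rintro z ⟨hz, hzS⟩
  exact le_antisymm hz (not_lt.1 (hmin z hzS))

theorem logicS4GrzBd_subset_topLogic_ordinalSpace {γ : Ordinal.{u}} {n : ℕ} (hn : 0 < n)
    (hγ : γ ≤ ω ^ n) : logicS4GrzBd n ⊆ topLogic (OrdinalSpace γ) := by
  refine logicS4GrzBd_subset_topLogic (logicS4Grz_subset_topLogic_ordinalSpace γ)
    (fun a => omegaRank n a.1) (fun a => ?_) fun a => omegaRank_lt (a.2.trans_le hγ) hn
  obtain ⟨U, hU, haU, h⟩ := exists_isOpen_omegaRank_lt (a.2.trans_le hγ)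
  exact ⟨Subtype.val ⁻¹' U, hU.preimage continuous_subtype_val, haU,
    fun b hb hne => h b.1 hb fun h' => hne (Subtype.ext h')⟩

theorem topLogic_ordinalSpace_subset_omegaPowInterval {γ : Ordinal.{u}} {k : ℕ} (h : ω ^ k < γ) :
    topLogic (OrdinalSpace γ) ⊆ topLogic (OmegaPowInterval.{u} k) := by
  have hsub : OmegaPowInterval.{u} k ⊆ Set.Iio γ := fun a ha => ha.2.trans_lt h
  have hopen : IsOpen (OmegaPowInterval.{u} k) := by
    rw [OmegaPowInterval, ← Set.Ioi_inter_Iic]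
    exact isOpen_Ioi.inter (isOpen_Iic_ordinal _)
  refine topLogic_subset_of_isOpenEmbedding (f := Set.inclusion hsub) ?_
  exact ⟨Topology.IsEmbedding.inclusion hsub, by
    rw [Set.range_inclusion]; exact hopen.preimage continuous_subtype_val⟩

theorem topLogic_ordinalSpace_eq_logicS4GrzBd {δ : Ordinal.{u}} {k : ℕ} (h₁ : ω ^ k ≤ δ)
    (h₂ : δ < ω ^ (k + 1)) : topLogic (OrdinalSpace (δ + 1)) = logicS4GrzBd (k + 1) :=
  ((topLogic_ordinalSpace_subset_omegaPowInterval (h₁.trans_lt (lt_add_one δ))).trans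
    (topLogic_omegaPowInterval_subset_logicS4GrzBd k)).antisymm
    (logicS4GrzBd_subset_topLogic_ordinalSpace k.succ_pos (Order.add_one_le_of_lt h₂))

theorem topLogic_ordinalSpace_one : topLogic (OrdinalSpace (1 : Ordinal.{u})) = logicS4GrzBd 1 := by
  refine Set.Subset.antisymm ?_ (logicS4GrzBd_subset_topLogic_ordinalSpace one_pos
    (by simpa using Ordinal.one_lt_omega0.le))
  let _ : Unique (OrdinalSpace (1 : Ordinal.{u})) :=
    ⟨⟨⟨0, Set.mem_Iio.2 zero_lt_one⟩⟩, fun a => Subtype.ext (Order.lt_one_iff.1 a.2)⟩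
  let _ : Unique (OmegaPowInterval.{u} 0) :=
    ⟨⟨⟨1, zero_lt_one, by simp⟩⟩, fun a => Subtype.ext
      (le_antisymm (by simpa using a.2.2) (Order.one_le_iff_pos.2 a.2.1))⟩
  rw [topLogic_congr (Homeomorph.homeomorphOfUnique _ (OmegaPowInterval.{u} 0))]
  exact topLogic_omegaPowInterval_subset_logicS4GrzBd 0

theorem topLogic_ordinalSpace_eq_logicS4Grz {δ : Ordinal.{u}} (h : ∀ k : ℕ, ω ^ k ≤ δ) :
    topLogic (OrdinalSpace (δ + 1)) = logicS4Grz := by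
  refine Set.Subset.antisymm ?_ (logicS4Grz_subset_topLogic_ordinalSpace _)
  refine (Set.subset_iInter fun k => ?_).trans
    iInter_topLogic_omegaPowInterval_subset_logicS4Grz.{u}
  exact topLogic_ordinalSpace_subset_omegaPowInterval ((h k).trans_lt (lt_add_one δ))

instance compactSpace_ordinalSpace_add_one (δ : Ordinal.{u}) :
    CompactSpace (OrdinalSpace (δ + 1)) := by
  rw [← isCompact_iff_compactSpace, Set.Iio_add_one_eq_Iic, ← Set.Icc_bot]
  exact isCompact_Icc

theorem logicBeta_add_one (δ : Ordinal.{u}) :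
    logicBeta (δ + 1) = topLogic (OrdinalSpace (δ + 1)) := by
  obtain ⟨e⟩ := nonempty_homeomorph_stoneCech_of_compact (OrdinalSpace (δ + 1))
  exact topLogic_congr e

/-- The ordinal space `(δ + 1) + ε` is the disjoint sum of the clopen interval `[0, δ]` and of the
interval `[δ + 1, δ + 1 + ε)`, which is order isomorphic to `ε`. -/
theorem nonempty_homeomorph_ordinalSpace_add (δ ε : Ordinal.{u}) :
    Nonempty (OrdinalSpace (δ + 1 + ε) ≃ₜ OrdinalSpace (δ + 1) ⊕ OrdinalSpace ε) := by
  let f : OrdinalSpace (δ + 1) ⊕ OrdinalSpace ε → OrdinalSpace (δ + 1 + ε) :=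
    Sum.elim (fun a => ⟨a.1, Set.mem_Iio.2 (lt_of_lt_of_le a.2 le_self_add)⟩)
      (fun b => ⟨δ + 1 + b.1, Set.mem_Iio.2 ((add_lt_add_iff_left _).2 b.2)⟩)
  let e : OrdinalSpace ε ≃o Set.Ico (δ + 1) (δ + 1 + ε) :=
    { toFun := fun b => ⟨δ + 1 + b.1, le_self_add, (add_lt_add_iff_left _).2 b.2⟩
      invFun := fun x => ⟨x.1 - (δ + 1), by
        have h := x.2.2
        rw [← Ordinal.add_sub_cancel_of_le x.2.1] at h
        exact lt_of_add_lt_add_left h⟩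
      left_inv := fun b => Subtype.ext (Ordinal.add_sub_cancel _ _)
      right_inv := fun x => Subtype.ext (Ordinal.add_sub_cancel_of_le x.2.1)
      map_rel_iff' := by
        intro a b
        simp [← Subtype.coe_le_coe] }
  have hopen : IsOpen (Set.Ico (δ + 1) (δ + 1 + ε)) := by
    rw [show Set.Ico (δ + 1) (δ + 1 + ε) = Set.Ioo δ (δ + 1 + ε) by
      ext x; simp [Order.add_one_le_iff]]
    exact isOpen_Ioo
  have hval : ∀ γ : Ordinal.{u},
      Topology.IsOpenEmbedding (Subtype.val : OrdinalSpace γ → Ordinal) :=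
    fun γ => isOpen_Iio.isOpenEmbedding_subtypeVal
  have hr : Topology.IsOpenEmbedding fun b : OrdinalSpace ε => f (Sum.inr b) := by
    refine .of_comp _ (hval _) ?_
    exact hopen.isOpenEmbedding_subtypeVal.comp e.toHomeomorph.isOpenEmbedding
  have hl : Topology.IsOpenEmbedding fun a : OrdinalSpace (δ + 1) => f (Sum.inl a) :=
    .of_comp _ (hval _) (hval _)
  have hinj : Function.Injective f := by
    refine hl.injective.sumElim hr.injective fun a b h => ?_
    have h : a.1 = δ + 1 + b.1 := congr_arg Subtype.val h
    exact (a.2.trans_le le_self_add).ne h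
  have hsurj : Function.Surjective f := by
    intro x
    rcases lt_or_ge x.1 (δ + 1) with h | h
    · exact ⟨Sum.inl ⟨x.1, h⟩, rfl⟩
    · exact ⟨Sum.inr (e.symm ⟨x.1, h, x.2⟩), Subtype.ext (Ordinal.add_sub_cancel_of_le h)⟩
  have hcont : Continuous f := continuous_sum_dom.2 ⟨hl.continuous, hr.continuous⟩
  have hmap : IsOpenMap f := isOpenMap_sum.2 ⟨hl.isOpenMap, hr.isOpenMap⟩
  exact ⟨((Equiv.ofBijective f ⟨hinj, hsurj⟩).toHomeomorphOfContinuousOpen hcont hmap).symm⟩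

theorem logicBeta_add (δ ε : Ordinal.{u}) :
    logicBeta (δ + 1 + ε) = topLogic (OrdinalSpace (δ + 1)) ∩ logicBeta ε := by
  obtain ⟨e⟩ := nonempty_homeomorph_ordinalSpace_add δ ε
  obtain ⟨e'⟩ := nonempty_homeomorph_stoneCech_sum (OrdinalSpace (δ + 1)) (OrdinalSpace ε)
  obtain ⟨e''⟩ := nonempty_homeomorph_stoneCech_congr e
  rw [logicBeta, topLogic_congr (e''.trans e'), topLogic_sum, ← logicBeta, logicBeta_add_one]
  rfl

/-! ### The logics of the compactified ordinals -/

theorem forall_omega0_pow_le_or {δ : Ordinal.{u}} (h : δ ≠ 0) :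
    (∀ k : ℕ, ω ^ k ≤ δ) ∨ ∃ k : ℕ, ω ^ k ≤ δ ∧ δ < ω ^ (k + 1) := by
  classical
  by_cases hex : ∃ n : ℕ, δ < ω ^ n
  · right
    rcases hn : Nat.find hex with _ | k
    · have := Nat.find_spec hex
      rw [hn, pow_zero] at this
      exact absurd (Order.lt_one_iff.1 this) h
    · exact ⟨k, not_lt.1 (Nat.find_min hex (by omega)), hn ▸ Nat.find_spec hex⟩
  · exact Or.inl fun k => not_lt.1 fun h => hex ⟨k, h⟩

theorem omega0_pow_le_omega0_opow_omega0 (k : ℕ) :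
    (ω : Ordinal.{u}) ^ k ≤ ω ^ (ω : Ordinal.{u}) := by
  rw [← Ordinal.opow_natCast]
  exact Ordinal.opow_le_opow_right Ordinal.omega0_pos (Ordinal.natCast_lt_omega0 k).le

/-- As `1 + ω ^ m = ω ^ m`, the ordinal `ω ^ m * (c + 1)` decomposes into the compact interval
`[0, ω ^ m * c]` followed by a copy of `ω ^ m`. -/
theorem logicBeta_omega0_pow_mul {m : ℕ} (hm : 0 < m) (c : Ordinal.{u}) :
    logicBeta (ω ^ m * (c + 1) : Ordinal.{u}) =
      topLogic (OrdinalSpace (ω ^ m * c + 1)) ∩ logicBetaOmegaPow.{u} m := by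
  have h : (ω : Ordinal.{u}) ≤ ω ^ m := by
    simpa using pow_le_pow_right₀ Ordinal.one_lt_omega0.le hm
  rw [logicBetaOmegaPow, ← logicBeta_add, add_assoc, Ordinal.one_add_of_omega0_le h, mul_add_one]

theorem omega0_pow_mul_add_one_ne_zero (m : ℕ) (c : Ordinal.{u}) :
    (ω : Ordinal.{u}) ^ m * (c + 1) ≠ 0 :=
  mul_ne_zero (omega0_pow_pos m).ne' (Order.succ_eq_add_one c ▸ Order.succ_ne_bot c)

theorem exists_ordinal_of_eq {L : Set ModalFormula} {m : ℕ} {c : Ordinal.{u}}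
    (h : L = logicBeta (ω ^ m * (c + 1) : Ordinal.{u})) :
    ∃ (γ : Ordinal.{u}) (hγ : γ ≠ 0), L = logicBeta γ ∧ leastCNFExponent γ hγ < ω :=
  ⟨_, omega0_pow_mul_add_one_ne_zero m c, h, leastCNFExponent_lt _ rfl⟩

theorem mainTheorem2 (L : Set ModalFormula) (hL : IsLogicAboveS4 L) :
    (∃ (γ : Ordinal.{u}) (hγ : γ ≠ 0), L = logicBeta γ ∧ leastCNFExponent γ hγ < ω) ↔
      ((∃ m : ℕ, 0 < m ∧ L = logicBetaOmegaPow.{u} m) ∨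
        (L = logicS4Grz ∨ ∃ n : ℕ, 0 < n ∧ L = logicS4GrzBd n) ∨
        ((∃ m : ℕ, 0 < m ∧ L = logicS4Grz ∩ logicBetaOmegaPow.{u} m) ∨
          ∃ m n : ℕ, 0 < m ∧ m < n ∧ L = logicS4GrzBd n ∩ logicBetaOmegaPow.{u} m)) := by
  constructor
  · rintro ⟨γ, hγ, rfl, hlt⟩
    obtain ⟨m, c, rfl⟩ := exists_eq_of_leastCNFExponent_lt hlt
    rcases Nat.eq_zero_or_pos m with rfl | hm
    · right; left
      rw [pow_zero, one_mul, logicBeta_add_one]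
      rcases eq_or_ne c 0 with rfl | hc
      · exact Or.inr ⟨1, one_pos, by rw [zero_add]; exact topLogic_ordinalSpace_one⟩
      rcases forall_omega0_pow_le_or hc with h | ⟨k, h₁, h₂⟩
      · exact Or.inl (topLogic_ordinalSpace_eq_logicS4Grz h)
      · exact Or.inr ⟨k + 1, k.succ_pos, topLogic_ordinalSpace_eq_logicS4GrzBd h₁ h₂⟩
    · rcases eq_or_ne c 0 with rfl | hc
      · exact Or.inl ⟨m, hm, by rw [zero_add, mul_one, logicBetaOmegaPow]⟩
      right; right
      rw [logicBeta_omega0_pow_mul hm]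
      have hne : (ω : Ordinal.{u}) ^ m * c ≠ 0 := mul_ne_zero (omega0_pow_pos m).ne' hc
      rcases forall_omega0_pow_le_or hne with h | ⟨k, h₁, h₂⟩
      · exact Or.inl ⟨m, hm, by rw [topLogic_ordinalSpace_eq_logicS4Grz h]⟩
      · refine Or.inr ⟨m, k + 1, hm, ?_, by rw [topLogic_ordinalSpace_eq_logicS4GrzBd h₁ h₂]⟩
        exact (pow_lt_pow_iff_right₀ Ordinal.one_lt_omega0).1
          ((Ordinal.le_of_dvd hne (dvd_mul_right _ _)).trans_lt h₂)
  · have hGrz := topLogic_ordinalSpace_eq_logicS4Grz omega0_pow_le_omega0_opow_omega0.{u}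
    have hBd := fun k => topLogic_ordinalSpace_eq_logicS4GrzBd (le_refl ((ω : Ordinal.{u}) ^ k))
      (pow_lt_pow_right₀ Ordinal.one_lt_omega0 k.lt_succ_self)
    rintro (⟨m, -, rfl⟩ | (rfl | ⟨n, hn, rfl⟩) | ⟨m, hm, rfl⟩ | ⟨m, n, hm, hmn, rfl⟩)
    · exact exists_ordinal_of_eq (m := m) (c := 0) (by rw [zero_add, mul_one, logicBetaOmegaPow])
    · exact exists_ordinal_of_eq (m := 0) (c := ω ^ (ω : Ordinal.{u}))
        (by rw [pow_zero, one_mul, logicBeta_add_one, hGrz])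
    · obtain ⟨k, rfl⟩ := Nat.exists_eq_succ_of_ne_zero hn.ne'
      exact exists_ordinal_of_eq (m := 0) (c := ω ^ k)
        (by rw [pow_zero, one_mul, logicBeta_add_one, hBd])
    · -- The ordinal `ω ^ ω + ω ^ m`.
      obtain ⟨c, hc⟩ : (ω : Ordinal.{u}) ^ m ∣ ω ^ (ω : Ordinal.{u}) := by
        rw [← Ordinal.opow_natCast]
        exact Ordinal.opow_dvd_opow ω (Ordinal.natCast_lt_omega0 m).le
      exact exists_ordinal_of_eq (m := m) (c := c)
        (by rw [logicBeta_omega0_pow_mul hm, ← hc, hGrz])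
    · -- The ordinal `ω ^ (n - 1) + ω ^ m`.
      obtain ⟨k, rfl⟩ := Nat.exists_eq_succ_of_ne_zero (hm.trans hmn).ne'
      obtain ⟨c, hc⟩ : (ω : Ordinal.{u}) ^ m ∣ ω ^ k := pow_dvd_pow _ (Nat.le_of_lt_succ hmn)
      exact exists_ordinal_of_eq (m := m) (c := c)
        (by rw [logicBeta_omega0_pow_mul hm, ← hc, hBd])
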